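/- An \emph{xor-clause} is an equation $x_1\oplus\dots\oplus x_k\equiv p$ with pairwise distinct propositional variables $x_1,\dots,x_k$ ($k\ge 0$) and $p\in\{\bot,\top\}$; $x_1\oplus\dots\oplus x_k$ without right-hand side means $x_1\oplus\dots\oplus x_k\equiv\top$. The empty clause $\bot\equiv\top$ is identified with $\bot$ and the empty clause $\bot\equiv\bot$ with $\top$; the literals $x$ and $\neg x$ are identified with $x\equiv\top$ and $x\equiv\bot$, and \emph{literals} are the xor-clauses with at most one variable. For a finite conjunction $\phi$ of xor-clauses, $\operatorname{vars}(\phi)$ is the set of variables occurring in it. An xor-clause is \emph{UP-derivable} from $\phi$ if it can be obtained from the clauses of $\phi$ by repeatedly applying the rule: from $x\equiv p$ and an xor-clause $C$ infer the clause obtained from $C$ by substituting $p$ for $x$. An xor-clause is \emph{EC-derivable} from $\phi$ if it can be obtained from the clauses of $\phi$ by the following rules, where $x,y,z$ are distinct variables, $x_1,\dots,x_m$ ($m\ge2$) are distinct variables, and in (d) $y\notin\{x_1,x_m\}$: (a) from $x\equiv\top$ and $x\equiv\bot$ infer $\bot$; (b) from $x\equiv p$ and $x\oplus y\equiv q$ infer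 $y\equiv p\oplus q$; (c) from $x\equiv p$ and $x\oplus y\oplus z\equiv q$ infer $y\oplus z\equiv p\oplus q$; (d) from $x_1\oplus x_2\equiv p_1,\ \dots,\ x_{m-1}\oplus x_m\equiv p_{m-1}$ and $x_1\oplus x_m\oplus y\equiv q$ infer $y\equiv p_1\oplus\dots\oplus p_{m-1}\oplus q$; (e) from $x_1\oplus x_2\equiv p_1,\ \dots,\ x_{m-1}\oplus x_m\equiv p_{m-1},\ x_m\oplus x_1\equiv p_m$ with $p_1\oplus\dots\oplus p_m=\top$ infer $\bot$. A finite conjunction $\psi$ of xor-clauses is an \emph{EC-simulation formula} for $\phi$ if (i) the satisfying truth assignments of $\phi$ are exactly those of $\phi\land\psi$ when projected to $\operatorname{vars}(\phi)$, and (ii) for all literals $\tilde l_1,\dots,\tilde l_k,\hat l$: if $\hat l$ is EC-derivable from $\phi\land\tilde l_1\land\dots\land\tilde l_k$, then $\hat l$ is UP-derivable from $\phi\land\psi\land\tilde l_1\land\dots\land\tilde l_k$. For $n\ge1$ let $$D(n)=(x_1\oplus x_{n+1}\oplus y)\land\bigwedge_{i=1}^n\bigl[(x_i\oplus x_{i,a}\oplus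 x_{i,b})\land(x_{i,b}\oplus x_{i,c}\oplus x_{i+1})\land(x_i\oplus x_{i,d}\oplus x_{i,e})\land(x_{i,e}\oplus x_{i,f}\oplus x_{i+1})\bigr],$$ where all the named variables are distinct. Then every EC-simulation formula $\psi$ for $D(n)$ with $\operatorname{vars}(\psi)\subseteq\operatorname{vars}(D(n))$ contains at least $2^n$ xor-clauses. -/

import Mathlib

namespace XorReasoning

/-- An xor-clause over variables `V` in normal form, written as an equation
`x₁ ⊕ ... ⊕ xₖ ≡ rhs` with pairwise distinct variables.  The truth values `⊥`, `⊤` are `0`, `1` in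
`ZMod 2`; the normal form `x₁ ⊕ ... ⊕ xₖ` is the equation with `rhs = 1`, and
`x₁ ⊕ ... ⊕ xₖ ⊕ ⊤` the one with `rhs = 0`. -/
@[ext]
structure XorClause (V : Type*) where
  vars : Finset V
  rhs : ZMod 2
deriving DecidableEq

/-- A (finite) conjunction of xor-clauses. -/
abbrev XorConj (V : Type*) := Finset (XorClause V)

namespace XorClause

variable {V : Type*}

/-- The unary xor-clause `x ≡ p`: the literal `x` if `p = 1` and `¬x` if `p = 0`. -/
def unit (x : V) (p : ZMod 2) : XorClause V := ⟨{x}, p⟩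

/-- The empty xor-clause `()`, which is `⊥`. -/
def bot : XorClause V := ⟨∅, 1⟩

/-- The xor-clause `x ⊕ y ≡ p` (used for distinct variables). -/
def binary [DecidableEq V] (x y : V) (p : ZMod 2) : XorClause V := ⟨{x, y}, p⟩

/-- The xor-clause `x ⊕ y ⊕ z ≡ p` (used for distinct variables). -/
def ternary [DecidableEq V] (x y z : V) (p : ZMod 2) : XorClause V := ⟨{x, y, z}, p⟩

/-- Literals, identified with xor-clauses with at most one variable: `x`, `¬x`, `⊤`, `⊥`. -/
def IsLiteral (C : XorClause V) : Prop := C.vars.card ≤ 1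

/-- The (normal form of the) result of substituting the constant `p` for the variable `x`. -/
def substConst [DecidableEq V] (C : XorClause V) (x : V) (p : ZMod 2) : XorClause V :=
  if x ∈ C.vars then ⟨C.vars.erase x, C.rhs + p⟩ else C

/-- The truth assignment `τ` satisfies the xor-clause `C`. -/
def Sat (τ : V → ZMod 2) (C : XorClause V) : Prop := ∑ x ∈ C.vars, τ x = C.rhs

end XorClause

open XorClause

variable {V : Type*} [DecidableEq V]

/-- The variables occurring in a conjunction of xor-clauses. -/
def varsOf (φ : XorConj V) : Finset V := φ.biUnion XorClause.vars

/-- The truth assignment `τ` satisfies the conjunction `φ`. -/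
def Satisfies (τ : V → ZMod 2) (φ : XorConj V) : Prop := ∀ C ∈ φ, Sat τ C

/-- `UPDerivable φ C`: the xor-clause `C` is derivable from `φ` by unit propagation. -/
inductive UPDerivable (φ : XorConj V) : XorClause V → Prop
  | mem {C : XorClause V} : C ∈ φ → UPDerivable φ C
  /-- The rules `⊕-Unit⁺` (`p = 1`) and `⊕-Unit⁻` (`p = 0`). -/
  | unit {x : V} {p : ZMod 2} {C : XorClause V} :
      UPDerivable φ (unit x p) → UPDerivable φ C → UPDerivable φ (C.substConst x p)

/-- `ECDerivable φ C`: the xor-clause `C` is derivable from `φ` in the equivalence class based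
system EC.  The rules are stated for xor-clauses in equation form. -/
inductive ECDerivable (φ : XorConj V) : XorClause V → Prop
  | mem {C : XorClause V} : C ∈ φ → ECDerivable φ C
  /-- `Conflict` -/
  | conflict {x : V} :
      ECDerivable φ (unit x 1) → ECDerivable φ (unit x 0) → ECDerivable φ bot
  /-- `⊕-Unit²` -/
  | unit2 {x y : V} {p q : ZMod 2} : x ≠ y →
      ECDerivable φ (unit x p) → ECDerivable φ (binary x y q) →
      ECDerivable φ (unit y (p + q))
  /-- `⊕-Unit³` -/
  | unit3 {x y z : V} {p q : ZMod 2} : x ≠ y → x ≠ z → y ≠ z →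
      ECDerivable φ (unit x p) → ECDerivable φ (ternary x y z q) →
      ECDerivable φ (binary y z (p + q))
  /-- `⊕-Imply`, for a chain of `k + 2` distinct variables joined by `k + 1` equivalences -/
  | imply {k : ℕ} {x : Fin (k + 2) → V} {y : V} {p : Fin (k + 1) → ZMod 2} {q : ZMod 2} :
      Function.Injective x → y ≠ x 0 → y ≠ x (Fin.last (k + 1)) →
      (∀ i : Fin (k + 1), ECDerivable φ (binary (x i.castSucc) (x i.succ) (p i))) →
      ECDerivable φ (ternary (x 0) (x (Fin.last (k + 1))) y q) →
      ECDerivable φ (unit y ((∑ i, p i) + q))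
  /-- `⊕-Conflict`, for a cycle of `k + 2` distinct variables -/
  | cycleConflict {k : ℕ} {x : Fin (k + 2) → V} {p : Fin (k + 1) → ZMod 2} {q : ZMod 2} :
      Function.Injective x →
      (∀ i : Fin (k + 1), ECDerivable φ (binary (x i.castSucc) (x i.succ) (p i))) →
      ECDerivable φ (binary (x (Fin.last (k + 1))) (x 0) q) →
      (∑ i, p i) + q = 1 →
      ECDerivable φ bot

/-- `ψ` is an EC-simulation formula for `φ`: (i) the satisfying truth assignments of `φ` are
exactly those of `φ ∧ ψ` when projected to the variables of `φ`, and (ii) each literal that is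
EC-derivable from `φ` and a conjunction `L` of assumption literals is UP-derivable from `φ ∧ ψ`
and `L`. -/
def IsECSimulation (φ ψ : XorConj V) : Prop :=
  (∀ τ : V → ZMod 2,
    Satisfies τ φ ↔ ∃ τ' : V → ZMod 2, Satisfies τ' (φ ∪ ψ) ∧ ∀ x ∈ varsOf φ, τ' x = τ x) ∧
  ∀ (L : XorConj V) (l : XorClause V), (∀ l' ∈ L, IsLiteral l') → IsLiteral l →
    ECDerivable (φ ∪ L) l → UPDerivable (φ ∪ ψ ∪ L) l

/-- Pairwise distinct propositional variables `y`, `xᵢ`, `xᵢₐ`, ..., `x_{i,f}` for all `i : ℕ`. -/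
inductive DVar
  | y
  | x (i : ℕ)
  | xa (i : ℕ)
  | xb (i : ℕ)
  | xc (i : ℕ)
  | xd (i : ℕ)
  | xe (i : ℕ)
  | xf (i : ℕ)
deriving DecidableEq

open DVar in
/-- The `i`-th diamond gadget, which connects `xᵢ` and `x_{i+1}`. -/
def gadget (i : ℕ) : XorConj DVar :=
  {ternary (x i) (xa i) (xb i) 1, ternary (xb i) (xc i) (x (i + 1)) 1,
   ternary (x i) (xd i) (xe i) 1, ternary (xe i) (xf i) (x (i + 1)) 1}

open DVar in
/-- The conjunction `D(n)` (meant for `n ≥ 1`): a chain of `n` diamond gadgets, closed by the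
xor-clause `x₁ ⊕ x_{n+1} ⊕ y`. -/
def D (n : ℕ) : XorConj DVar :=
  insert (ternary (x 1) (x (n + 1)) y 1) ((Finset.Icc 1 n).biUnion gadget)

end XorReasoning

/-!
Fix a set `s` of gadgets to be traversed along the upper branch, the others being traversed along
the lower one, and assume every side variable (`xₐ`, `x_c` or `x_d`, `x_f`) of the resulting path to
be true. EC then turns the path into a chain of equivalences from `x₁` to `x_{n+1}` and derives `y`
(`ecDerivable_y`), so unit propagation has to derive `y` as well.

The first propagation to a variable `v` that is not assumed uses a clause whose variables are `v`
and assumed side variables. Every clause of `ψ` is a consequence of `D n`, so its variables have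
parity zero against each shift of the solution space of `D n` (`sum_vars_eq_zero`). Explicit shifts
then force `v = y` and force all the assumed side variables to occur
(`vars_eq_of_subset_insert`): the clause has variable set exactly `insert y (sideVars n s)`, and it
has to lie in `ψ` since every clause of `D n` contains some `xᵢ`. The `2 ^ n` choices of `s` give
pairwise distinct variable sets, hence as many clauses of `ψ`.
-/

namespace XorReasoning

open DVar XorClause

theorem sum_ternary {W : Type*} [DecidableEq W] {a b c : W} {p : ZMod 2} (δ : W → ZMod 2)
    (hab : a ≠ b) (hac : a ≠ c) (hbc : b ≠ c) :
    ∑ v ∈ (ternary a b c p).vars, δ v = δ a + δ b + δ c := by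
  have h1 : a ∉ ({b, c} : Finset W) := by simp [hab, hac]
  have h2 : b ∉ ({c} : Finset W) := by simp [hbc]
  change ∑ v ∈ {a, b, c}, δ v = _
  rw [Finset.sum_insert h1, Finset.sum_insert h2, Finset.sum_singleton, add_assoc]

theorem mem_D {n : ℕ} {K : XorClause DVar} :
    K ∈ D n ↔ K = ternary (x 1) (x (n + 1)) y 1 ∨ ∃ i, (1 ≤ i ∧ i ≤ n) ∧
      (K = ternary (x i) (xa i) (xb i) 1 ∨ K = ternary (xb i) (xc i) (x (i + 1)) 1 ∨
        K = ternary (x i) (xd i) (xe i) 1 ∨ K = ternary (xe i) (xf i) (x (i + 1)) 1) := by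
  simp [D, gadget]

/-- `δ` solves the homogeneous system of `D n`: adding it to a solution of `D n` gives another. -/
def IsShift (n : ℕ) (δ : DVar → ZMod 2) : Prop := ∀ K ∈ D n, ∑ v ∈ K.vars, δ v = 0

theorem isShift_of_equations {n : ℕ} (hn : 1 ≤ n) {δ : DVar → ZMod 2}
    (hy : δ (x 1) + δ (x (n + 1)) + δ y = 0)
    (hab : ∀ i, δ (x i) + δ (xa i) + δ (xb i) = 0)
    (hbc : ∀ i, δ (xb i) + δ (xc i) + δ (x (i + 1)) = 0)
    (hde : ∀ i, δ (x i) + δ (xd i) + δ (xe i) = 0)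
    (hef : ∀ i, δ (xe i) + δ (xf i) + δ (x (i + 1)) = 0) : IsShift n δ := by
  intro K hK
  rcases mem_D.1 hK with rfl | ⟨i, -, rfl | rfl | rfl | rfl⟩
  · rw [sum_ternary δ (by simp; omega) (by simp) (by simp), hy]
  · rw [sum_ternary δ (by simp) (by simp) (by simp), hab]
  · rw [sum_ternary δ (by simp) (by simp) (by simp), hbc]
  · rw [sum_ternary δ (by simp) (by simp) (by simp), hde]
  · rw [sum_ternary δ (by simp) (by simp) (by simp), hef]

/-- The clause `C` is a logical consequence of `D n`. -/
def Implied (n : ℕ) (C : XorClause DVar) : Prop := ∀ τ, Satisfies τ (D n) → Sat τ C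

theorem satisfies_one {n : ℕ} (hn : 1 ≤ n) : Satisfies (fun _ => 1) (D n) := by
  have h3 : (1 + 1 + 1 : ZMod 2) = 1 := by decide
  intro K hK
  rcases mem_D.1 hK with rfl | ⟨i, -, rfl | rfl | rfl | rfl⟩
  · exact (sum_ternary _ (by simp; omega) (by simp) (by simp)).trans h3
  all_goals exact (sum_ternary _ (by simp) (by simp) (by simp)).trans h3

/-- A consequence of `D n` holds both at the all-true solution and at its translate by `δ`. -/
theorem sum_vars_eq_zero {n : ℕ} (hn : 1 ≤ n) {C : XorClause DVar} (hC : Implied n C)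
    {δ : DVar → ZMod 2} (hδ : IsShift n δ) : ∑ v ∈ C.vars, δ v = 0 := by
  have h1 : Sat (fun _ => 1) C := hC _ (satisfies_one hn)
  have h2 : Sat (fun v => 1 + δ v) C := by
    refine hC _ fun K hK => ?_
    have := satisfies_one hn K hK
    unfold Sat at *
    rw [Finset.sum_add_distrib, hδ K hK, this, add_zero]
  unfold Sat at *
  rw [Finset.sum_add_distrib, h1] at h2
  simpa using h2

theorem not_mem_of_isShift {n : ℕ} (hn : 1 ≤ n) {C : XorClause DVar} (hC : Implied n C)
    {δ : DVar → ZMod 2} (hδ : IsShift n δ) {v : DVar} (hv : δ v = 1)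
    (h0 : ∀ w ∈ C.vars, w ≠ v → δ w = 0) : v ∉ C.vars := by
  intro hvC
  have := sum_vars_eq_zero hn hC hδ
  rw [Finset.sum_eq_single_of_mem v hvC h0, hv] at this
  exact one_ne_zero this

/-! ### Shifts of the solution space -/

/-- Flips the variables `xᵢ`, `x_{i,b}` and `x_{i,e}`, the nodes of all the branches. -/
def nodeShift : DVar → ZMod 2
  | x _ => 1
  | xb _ => 1
  | xe _ => 1
  | _ => 0

/-- Flips the interior of the upper branch of gadget `j`. -/
def upperShift (j : ℕ) : DVar → ZMod 2
  | xa i => if i = j then 1 else 0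
  | xb i => if i = j then 1 else 0
  | xc i => if i = j then 1 else 0
  | _ => 0

/-- Flips the interior of the lower branch of gadget `j`. -/
def lowerShift (j : ℕ) : DVar → ZMod 2
  | xd i => if i = j then 1 else 0
  | xe i => if i = j then 1 else 0
  | xf i => if i = j then 1 else 0
  | _ => 0

/-- Cuts gadget `j` at the first clause of each branch: flips `y`, the nodes behind the cut and the
side variables `x_{j,a}`, `x_{j,d}` on it. -/
def firstCut (j : ℕ) : DVar → ZMod 2
  | y => 1
  | x i => if j < i then 1 else 0
  | xa i => if i = j then 1 else 0
  | xb i => if j ≤ i then 1 else 0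
  | xc _ => 0
  | xd i => if i = j then 1 else 0
  | xe i => if j ≤ i then 1 else 0
  | xf _ => 0

/-- Cuts gadget `j` at the second clause of each branch: flips `y`, the nodes behind the cut and the
side variables `x_{j,c}`, `x_{j,f}` on it. -/
def secondCut (j : ℕ) : DVar → ZMod 2
  | y => 1
  | x i => if j < i then 1 else 0
  | xa _ => 0
  | xb i => if j < i then 1 else 0
  | xc i => if i = j then 1 else 0
  | xd _ => 0
  | xe i => if j < i then 1 else 0
  | xf i => if i = j then 1 else 0

theorem one_add_one_zmod_two : (1 + 1 : ZMod 2) = 0 := by decide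

theorem isShift_nodeShift {n : ℕ} (hn : 1 ≤ n) : IsShift n nodeShift := by
  apply isShift_of_equations hn <;> simp [nodeShift, one_add_one_zmod_two]

theorem isShift_upperShift {n : ℕ} (hn : 1 ≤ n) (j : ℕ) : IsShift n (upperShift j) := by
  apply isShift_of_equations hn <;> simp only [upperShift] <;> intros <;> (try split_ifs) <;>
    simp [one_add_one_zmod_two]

theorem isShift_lowerShift {n : ℕ} (hn : 1 ≤ n) (j : ℕ) : IsShift n (lowerShift j) := by
  apply isShift_of_equations hn <;> simp only [lowerShift] <;> intros <;> (try split_ifs) <;>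
    simp [one_add_one_zmod_two]

theorem isShift_firstCut {n : ℕ} {j : ℕ} (hj : 1 ≤ j) (hjn : j ≤ n) :
    IsShift n (firstCut j) := by
  apply isShift_of_equations (hj.trans hjn) <;> simp only [firstCut] <;> intros <;> split_ifs <;>
    first
    | omega
    | simp [one_add_one_zmod_two]

theorem isShift_secondCut {n : ℕ} {j : ℕ} (hj : 1 ≤ j) (hjn : j ≤ n) :
    IsShift n (secondCut j) := by
  apply isShift_of_equations (hj.trans hjn) <;> simp only [secondCut] <;> intros <;> split_ifs <;>
    first
    | omega
    | simp [one_add_one_zmod_two]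

/-! ### Side variables of a path -/

/-- The side variables of the path through `D n` that takes the upper branch of gadget `i` if
`i ∈ s` and its lower branch otherwise. -/
def sideVars (n : ℕ) (s : Finset ℕ) : Finset DVar :=
  (Finset.Icc 1 n).biUnion fun i => if i ∈ s then {xa i, xc i} else {xd i, xf i}

theorem mem_sideVars {n : ℕ} {s : Finset ℕ} {v : DVar} :
    v ∈ sideVars n s ↔ ∃ i, (1 ≤ i ∧ i ≤ n) ∧
      (i ∈ s ∧ (v = xa i ∨ v = xc i) ∨ i ∉ s ∧ (v = xd i ∨ v = xf i)) := by
  simp only [sideVars, Finset.mem_biUnion, Finset.mem_Icc]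
  refine exists_congr fun i => and_congr_right fun _ => ?_
  by_cases h : i ∈ s <;> simp [h]

theorem not_mem_sideVars_y {n : ℕ} {s : Finset ℕ} : y ∉ sideVars n s := by
  simp [mem_sideVars]

theorem insert_sideVars_injOn (n : ℕ) :
    Set.InjOn (fun s => insert y (sideVars n s)) ((Finset.Icc 1 n).powerset : Set (Finset ℕ)) := by
  have key : ∀ s ∈ (Finset.Icc 1 n).powerset, ∀ i, i ∈ s ↔ xa i ∈ insert y (sideVars n s) := by
    intro s hs i
    have h := Finset.mem_powerset.1 hs
    simp only [Finset.mem_insert, mem_sideVars]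
    constructor
    · intro hi
      exact Or.inr ⟨i, Finset.mem_Icc.1 (h hi), Or.inl ⟨hi, Or.inl rfl⟩⟩
    · rintro (h | ⟨j, -, ⟨hj, h | h⟩ | ⟨-, h | h⟩⟩)
      all_goals simp at h
      exact h ▸ hj
  intro s hs t ht hst
  ext i
  rw [key s hs, key t ht]
  exact iff_of_eq (congrArg (xa i ∈ ·) hst)

/-- If unit propagation can use the consequence `C` of `D n` to infer a value of `v` from values of
side variables of a path, then `v` is `y` and `C` contains all the side variables. -/
theorem vars_eq_of_subset_insert {n : ℕ} (hn : 1 ≤ n) {C : XorClause DVar} (hC : Implied n C)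
    (hCn : C.vars ⊆ varsOf (D n)) {s : Finset ℕ} {v : DVar} (hv : v ∈ C.vars)
    (hvs : v ∉ sideVars n s) (hsub : C.vars ⊆ insert v (sideVars n s)) :
    C.vars = insert y (sideVars n s) := by
  have hzero : ∀ δ : DVar → ZMod 2, IsShift n δ → δ v = 1 →
      ¬ ∀ w ∈ sideVars n s, δ w = 0 := fun δ hδ h1 h0 =>
    not_mem_of_isShift hn hC hδ h1
      (fun w hw hwv => h0 w (Finset.mem_of_mem_insert_of_ne (hsub hw) hwv)) hv
  have hnode : ∀ w ∈ sideVars n s, nodeShift w = 0 := by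
    intro w hw
    obtain ⟨i, -, ⟨-, rfl | rfl⟩ | ⟨-, rfl | rfl⟩⟩ := mem_sideVars.1 hw <;> rfl
  have hupper : ∀ j ∉ s, ∀ w ∈ sideVars n s, upperShift j w = 0 := by
    intro j hj w hw
    obtain ⟨i, -, ⟨hi, rfl | rfl⟩ | ⟨-, rfl | rfl⟩⟩ := mem_sideVars.1 hw
    · exact if_neg fun h : i = j => hj (h ▸ hi)
    · exact if_neg fun h : i = j => hj (h ▸ hi)
    · rfl
    · rfl
  have hlower : ∀ j ∈ s, ∀ w ∈ sideVars n s, lowerShift j w = 0 := by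
    intro j hj w hw
    obtain ⟨i, -, ⟨-, rfl | rfl⟩ | ⟨hi, rfl | rfl⟩⟩ := mem_sideVars.1 hw
    · rfl
    · rfl
    · exact if_neg fun h : i = j => hi (h ▸ hj)
    · exact if_neg fun h : i = j => hi (h ▸ hj)
  have hbound : ∀ i, (v = xa i ∨ v = xc i ∨ v = xd i ∨ v = xf i) → 1 ≤ i ∧ i ≤ n := by
    intro i hi
    obtain ⟨K, hK, hvK⟩ := Finset.mem_biUnion.1 (hCn hv)
    rcases mem_D.1 hK with rfl | ⟨j, hj, rfl | rfl | rfl | rfl⟩ <;>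
      rcases hi with rfl | rfl | rfl | rfl <;> simp [ternary] at hvK <;> exact hvK ▸ hj
  have hvy : v = y := by
    cases v with
    | y => rfl
    | x i => exact (hzero _ (isShift_nodeShift hn) rfl hnode).elim
    | xb i => exact (hzero _ (isShift_nodeShift hn) rfl hnode).elim
    | xe i => exact (hzero _ (isShift_nodeShift hn) rfl hnode).elim
    | xa i =>
      have hi : i ∉ s := fun h => hvs (mem_sideVars.2 ⟨i, hbound i (by simp), by simp [h]⟩)
      exact (hzero _ (isShift_upperShift hn i) (if_pos rfl) (hupper i hi)).elim
    | xc i =>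
      have hi : i ∉ s := fun h => hvs (mem_sideVars.2 ⟨i, hbound i (by simp), by simp [h]⟩)
      exact (hzero _ (isShift_upperShift hn i) (if_pos rfl) (hupper i hi)).elim
    | xd i =>
      have hi : i ∈ s := by
        by_contra h
        exact hvs (mem_sideVars.2 ⟨i, hbound i (by simp), by simp [h]⟩)
      exact (hzero _ (isShift_lowerShift hn i) (if_pos rfl) (hlower i hi)).elim
    | xf i =>
      have hi : i ∈ s := by
        by_contra h
        exact hvs (mem_sideVars.2 ⟨i, hbound i (by simp), by simp [h]⟩)
      exact (hzero _ (isShift_lowerShift hn i) (if_pos rfl) (hlower i hi)).elim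
  subst hvy
  refine hsub.antisymm (Finset.insert_subset hv fun u hu => ?_)
  -- The cut through `u` flips `y` but no side variable of the path other than `u`.
  have hcut : ∀ δ : DVar → ZMod 2, IsShift n δ → δ y = 1 →
      (∀ w ∈ sideVars n s, w ≠ u → δ w = 0) → u ∈ C.vars := by
    intro δ hδ h1 h0
    by_contra huC
    refine not_mem_of_isShift hn hC hδ h1 (fun w hw hwy => ?_) hv
    exact h0 w (Finset.mem_of_mem_insert_of_ne (hsub hw) hwy) fun h => huC (h ▸ hw)
  obtain ⟨j, hj, ⟨hjs, rfl | rfl⟩ | ⟨hjs, rfl | rfl⟩⟩ := mem_sideVars.1 hu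
  · refine hcut _ (isShift_firstCut hj.1 hj.2) rfl fun w hw hne => ?_
    obtain ⟨i, -, ⟨his, rfl | rfl⟩ | ⟨his, rfl | rfl⟩⟩ := mem_sideVars.1 hw <;>
      simp_all [firstCut]
    rintro rfl; exact his hjs
  · refine hcut _ (isShift_secondCut hj.1 hj.2) rfl fun w hw hne => ?_
    obtain ⟨i, -, ⟨his, rfl | rfl⟩ | ⟨his, rfl | rfl⟩⟩ := mem_sideVars.1 hw <;>
      simp_all [secondCut]
    rintro rfl; exact his hjs
  · refine hcut _ (isShift_firstCut hj.1 hj.2) rfl fun w hw hne => ?_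
    obtain ⟨i, -, ⟨his, rfl | rfl⟩ | ⟨his, rfl | rfl⟩⟩ := mem_sideVars.1 hw <;>
      simp_all [firstCut]
    rintro rfl; exact hjs his
  · refine hcut _ (isShift_secondCut hj.1 hj.2) rfl fun w hw hne => ?_
    obtain ⟨i, -, ⟨his, rfl | rfl⟩ | ⟨his, rfl | rfl⟩⟩ := mem_sideVars.1 hw <;>
      simp_all [secondCut]
    rintro rfl; exact hjs his

/-! ### Deriving `y` in EC -/

/-- The conjunction of assumptions making all the side variables of a path true. -/
def assumptions (n : ℕ) (s : Finset ℕ) : XorConj DVar :=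
  (sideVars n s).image fun v => unit v 1

/-- The `m`-th node of the path given by `s`, counted from `x₁` at `m = 0`. -/
def pathNode (s : Finset ℕ) (m : ℕ) : DVar :=
  if m % 2 = 0 then x (m / 2 + 1) else if m / 2 + 1 ∈ s then xb (m / 2 + 1) else xe (m / 2 + 1)

theorem pathNode_injective (s : Finset ℕ) : Function.Injective (pathNode s) := by
  intro a b h
  unfold pathNode at h
  split_ifs at h <;> simp at h <;> omega

/-- Rule `⊕-Unit³` with the assumption `v ≡ ⊤` and a clause on `u`, `v`, `w` of `D n`. -/
theorem ecDerivable_binary {n : ℕ} {s : Finset ℕ} {u v w : DVar} (hvu : v ≠ u) (hvw : v ≠ w)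
    (huw : u ≠ w) (hv : v ∈ sideVars n s) (hK : ternary u v w 1 ∈ D n) :
    ECDerivable (D n ∪ assumptions n s) (binary u w 0) := by
  have h1 : ECDerivable (D n ∪ assumptions n s) (unit v 1) :=
    .mem (Finset.mem_union_right _ (Finset.mem_image_of_mem _ hv))
  have h2 : ECDerivable (D n ∪ assumptions n s) (ternary v u w 1) := by
    have : ternary v u w 1 = ternary u v w 1 := by
      simp only [ternary, Finset.insert_comm]
    rw [this]
    exact .mem (Finset.mem_union_left _ hK)
  exact one_add_one_zmod_two ▸ ECDerivable.unit3 hvu hvw huw h1 h2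

theorem ecDerivable_pathNode {n : ℕ} (s : Finset ℕ) {m : ℕ} (hm : m < 2 * n) :
    ECDerivable (D n ∪ assumptions n s) (binary (pathNode s m) (pathNode s (m + 1)) 0) := by
  obtain ⟨j, rfl | rfl⟩ := Nat.even_or_odd' m
  · have e1 : 2 * j % 2 = 0 := by omega
    have e2 : (2 * j + 1) % 2 ≠ 0 := by omega
    have e3 : 2 * j / 2 = j := by omega
    have e4 : (2 * j + 1) / 2 = j := by omega
    have hj : 1 ≤ j + 1 ∧ j + 1 ≤ n := by omega
    simp only [pathNode, if_pos e1, if_neg e2, e3, e4]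
    split_ifs with h
    · exact ecDerivable_binary (v := xa (j + 1)) (by simp) (by simp) (by simp)
        (mem_sideVars.2 ⟨j + 1, hj, by simp [h]⟩) (mem_D.2 (.inr ⟨j + 1, hj, by simp⟩))
    · exact ecDerivable_binary (v := xd (j + 1)) (by simp) (by simp) (by simp)
        (mem_sideVars.2 ⟨j + 1, hj, by simp [h]⟩) (mem_D.2 (.inr ⟨j + 1, hj, by simp⟩))
  · have e1 : (2 * j + 1 + 1) % 2 = 0 := by omega
    have e2 : (2 * j + 1) % 2 ≠ 0 := by omega
    have e3 : (2 * j + 1 + 1) / 2 = j + 1 := by omega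
    have e4 : (2 * j + 1) / 2 = j := by omega
    have hj : 1 ≤ j + 1 ∧ j + 1 ≤ n := by omega
    simp only [pathNode, if_pos e1, if_neg e2, e3, e4]
    split_ifs with h
    · exact ecDerivable_binary (v := xc (j + 1)) (by simp) (by simp) (by simp)
        (mem_sideVars.2 ⟨j + 1, hj, by simp [h]⟩) (mem_D.2 (.inr ⟨j + 1, hj, by simp⟩))
    · exact ecDerivable_binary (v := xf (j + 1)) (by simp) (by simp) (by simp)
        (mem_sideVars.2 ⟨j + 1, hj, by simp [h]⟩) (mem_D.2 (.inr ⟨j + 1, hj, by simp⟩))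

theorem ecDerivable_y {n : ℕ} (hn : 1 ≤ n) (s : Finset ℕ) :
    ECDerivable (D n ∪ assumptions n s) (unit y 1) := by
  -- A path has `2 * n` edges, so `⊕-Imply` is used with `k + 1 = 2 * n`.
  obtain ⟨k, hk⟩ : ∃ k, k + 1 = 2 * n := ⟨2 * n - 1, by omega⟩
  have h0 : pathNode s 0 = x 1 := rfl
  have h1 : pathNode s (k + 1) = x (n + 1) := by
    rw [hk, pathNode, if_pos (by omega), Nat.mul_div_cancel_left n two_pos]
  have key := ECDerivable.imply (φ := D n ∪ assumptions n s) (k := k)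
    (x := fun i => pathNode s i) (y := y) (p := fun _ => 0) (q := 1)
    ((pathNode_injective s).comp Fin.val_injective) (by simp [h0]) (by simp [h1])
    (fun i => by
      simpa using ecDerivable_pathNode s (m := i) (by omega))
    (by
      simp only [Fin.val_zero, Fin.val_last, h0, h1]
      exact .mem (Finset.mem_union_left _ (mem_D.2 (.inl rfl))))
  simpa using key

/-! ### Unit propagation -/

/-- If no clause with variable set `insert y (sideVars n s)` is present, unit propagation never
leaves the side variables: it only removes side variables from given clauses. -/
theorem exists_of_upDerivable {n : ℕ} (hn : 1 ≤ n) {s : Finset ℕ} {χ : XorConj DVar}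
    (hχ : ∀ C ∈ χ, Implied n C) (hχn : ∀ C ∈ χ, C.vars ⊆ varsOf (D n))
    (hmiss : ∀ C ∈ χ, C.vars ≠ insert y (sideVars n s)) {C : XorClause DVar}
    (hC : UPDerivable (χ ∪ assumptions n s) C) :
    ∃ K ∈ χ ∪ assumptions n s, C.vars ⊆ K.vars ∧ K.vars ⊆ C.vars ∪ sideVars n s := by
  induction hC with
  | mem h => exact ⟨_, h, subset_rfl, Finset.subset_union_left⟩
  | @unit v p C _ _ ihv ihC =>
    obtain ⟨K, hK, hCK, hKC⟩ := ihC
    refine ⟨K, hK, ?_⟩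
    have hv : v ∈ sideVars n s := by
      by_contra hvs
      obtain ⟨M, hM, hvM, hMv⟩ := ihv
      have hvM' : v ∈ M.vars := hvM (Finset.mem_singleton_self v)
      rcases Finset.mem_union.1 hM with hM | hM
      · exact hmiss M hM
          (vars_eq_of_subset_insert hn (hχ M hM) (hχn M hM) hvM' hvs hMv)
      · obtain ⟨w, hw, rfl⟩ := Finset.mem_image.1 hM
        exact hvs (Finset.mem_singleton.1 hvM' ▸ hw)
    unfold substConst
    split_ifs
    · refine ⟨(Finset.erase_subset _ _).trans hCK, fun w hw => ?_⟩
      rcases Finset.mem_union.1 (hKC hw) with h | h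
      · by_cases hwv : w = v
        · exact Finset.mem_union_right _ (hwv ▸ hv)
        · exact Finset.mem_union_left _ (Finset.mem_erase.2 ⟨hwv, h⟩)
      · exact Finset.mem_union_right _ h
    · exact ⟨hCK, hKC⟩

theorem exists_mem_vars_eq {n : ℕ} (hn : 1 ≤ n) {ψ : XorConj DVar}
    (hvars : varsOf ψ ⊆ varsOf (D n)) (hψ : IsECSimulation (D n) ψ) (s : Finset ℕ) :
    ∃ C ∈ ψ, C.vars = insert y (sideVars n s) := by
  by_contra! hmiss
  have hup : UPDerivable (D n ∪ ψ ∪ assumptions n s) (unit y 1) := by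
    refine hψ.2 _ _ (fun l hl => ?_) (Finset.card_singleton _).le (ecDerivable_y hn s)
    obtain ⟨v, -, rfl⟩ := Finset.mem_image.1 hl
    exact (Finset.card_singleton _).le
  have hsub : ∀ C ∈ D n ∪ ψ, C.vars ⊆ varsOf (D n) := by
    intro C hC
    rcases Finset.mem_union.1 hC with hC | hC
    · exact Finset.subset_biUnion_of_mem XorClause.vars hC
    · exact (Finset.subset_biUnion_of_mem XorClause.vars hC).trans hvars
  have himp : ∀ C ∈ D n ∪ ψ, Implied n C := by
    intro C hC τ hτ
    obtain ⟨τ', hτ', heq⟩ := (hψ.1 τ).1 hτ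
    exact (Finset.sum_congr rfl fun v hv => (heq v (hsub C hC hv)).symm).trans (hτ' C hC)
  have hmiss' : ∀ C ∈ D n ∪ ψ, C.vars ≠ insert y (sideVars n s) := by
    intro C hC h
    rcases Finset.mem_union.1 hC with hC | hC
    · have hx : ∀ i, x i ∉ C.vars := fun i => by simp [h, mem_sideVars]
      rcases mem_D.1 hC with rfl | ⟨i, -, rfl | rfl | rfl | rfl⟩
      · exact hx 1 (by simp [ternary])
      · exact hx i (by simp [ternary])
      · exact hx (i + 1) (by simp [ternary])
      · exact hx i (by simp [ternary])
      · exact hx (i + 1) (by simp [ternary])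
    · exact hmiss C hC h
  obtain ⟨K, hK, hyK, hKy⟩ := exists_of_upDerivable hn himp hsub hmiss' hup
  have hyK' : y ∈ K.vars := hyK (Finset.mem_singleton_self y)
  rcases Finset.mem_union.1 hK with hK | hK
  · exact hmiss' K hK
      (vars_eq_of_subset_insert hn (himp K hK) (hsub K hK) hyK' not_mem_sideVars_y hKy)
  · obtain ⟨w, hw, rfl⟩ := Finset.mem_image.1 hK
    exact not_mem_sideVars_y (Finset.mem_singleton.1 hyK' ▸ hw)

end XorReasoning

theorem lemma2 (n : ℕ) (hn : 1 ≤ n) (ψ : XorReasoning.XorConj XorReasoning.DVar)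
    (hvars : XorReasoning.varsOf ψ ⊆ XorReasoning.varsOf (XorReasoning.D n))
    (hψ : XorReasoning.IsECSimulation (XorReasoning.D n) ψ) :
    2 ^ n ≤ ψ.card := by
  calc 2 ^ n = (Finset.Icc 1 n).powerset.card := by simp
    _ ≤ (ψ.image XorReasoning.XorClause.vars).card :=
      Finset.card_le_card_of_injOn _ (fun s _ => Finset.mem_image.2
        (XorReasoning.exists_mem_vars_eq hn hvars hψ s)) (XorReasoning.insert_sideVars_injOn n)
    _ ≤ ψ.card := Finset.card_image_le
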